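/- Fix $K$ items with merit vector $\mu=(\mu_1,\dots,\mu_K)\in\mathbb{R}^K$, $\sum_i\mu_i=0$, and let $\epsilon_{ijk}$ ($1\le i<j\le K$, $k\ge 1$) be IID integrable random variables with mean zero (no finite variance is assumed). Put $Y_{ijk}=\mu_i-\mu_j+\epsilon_{ijk}$. For each $t\in\mathbb{N}$ let $n_{ij}(t)=n_{ji}(t)\ge 0$ be the (deterministic) number of comparisons of items $i$ and $j$ at stage $t$, and assume $n(t)=\sum_{i<j}n_{ij}(t)\to\infty$ as $t\to\infty$. The comparison graph $\mathcal{G}_t$ on $\{1,\dots,K\}$ has an edge between $i\ne j$ iff $n_{ij}(t)>0$. The least squares estimator (LSE) at stage $t$ is $$\widehat\mu_t=\arg\min\Big\{\sum_{i<j}\sum_{k=1}^{n_{ij}(t)}\big(Y_{ijk}-(m_i-m_j)\big)^2 \;:\; m\in\mathbb{R}^K,\ \sum_i m_i=0\Big\}.$$ The LSE is called strongly consistent if, with probability one, this minimizer is unique for all sufficiently large $t$ and $\widehat\mu_t\to\mu$ as $t\to\infty$. Consider the condition (C) there is a tree $\mathcal{T}$ with vertex set $\{1,\dots,K\}$, contained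 in $\mathcal{G}_t$ for all large $t$, such that $\min\{n_{ij}(t):(i,j)\in\mathcal{T}\}\to\infty$ as $t\to\infty$. Then: 1. If (C) holds, the LSE is strongly consistent. 2. If every $n_{ij}(t)$ is nondecreasing in $t$ (comparisons accumulate) and the errors are not almost surely equal to $0$, then the LSE is strongly consistent if and only if (C) holds. -/

import Mathlib

open MeasureTheory ProbabilityTheory Filter Topology

namespace PairedComparison

/-- Unordered pairs of distinct items among `K` items, represented as `(i, j)` with `i < j`. -/
abbrev Pair (K : ℕ) : Type := {p : Fin K × Fin K // p.1 < p.2}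

/-- The comparison graph of a design in which the pair `e` is compared `c e` times:
two items are joined when they have been compared at least once. -/
def compGraph {K : ℕ} (c : Pair K → ℕ) : SimpleGraph (Fin K) :=
  SimpleGraph.fromRel (fun i j => ∃ h : i < j, 0 < c ⟨(i, j), h⟩)

/-- The least squares objective
`Q(m) = ∑_{i < j} ∑_{k = 1}^{n_ij} (Y_ijk - (m_i - m_j))²`. -/
def Q {K : ℕ} (c : Pair K → ℕ) (y : Pair K → ℕ → ℝ) (m : Fin K → ℝ) : ℝ :=
  ∑ e : Pair K, ∑ k ∈ Finset.range (c e), (y e k - (m e.1.1 - m e.1.2)) ^ 2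

/-- `m` is a least squares estimate: it minimizes `Q` subject to `m_1 + ⋯ + m_K = 0`. -/
def IsLSE {K : ℕ} (c : Pair K → ℕ) (y : Pair K → ℕ → ℝ) (m : Fin K → ℝ) : Prop :=
  ∑ i, m i = 0 ∧ ∀ m' : Fin K → ℝ, ∑ i, m' i = 0 → Q c y m ≤ Q c y m'

/-- The outcomes `Y_ijk = μ_i - μ_j + ε_ijk`, `i < j`. -/
def outcome {K : ℕ} {Ω : Type*} (μ : Fin K → ℝ) (ε : Pair K → ℕ → Ω → ℝ)
    (ω : Ω) (e : Pair K) (k : ℕ) : ℝ :=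
  μ e.1.1 - μ e.1.2 + ε e k ω

/-- Some fixed spanning tree `T` of the comparison graph satisfies
`min {n_ij : (i, j) ∈ T} → ∞` along the sequence of designs `n t`. -/
def TreeCondition {K : ℕ} (n : ℕ → Pair K → ℕ) : Prop :=
  ∃ T : SimpleGraph (Fin K), T.IsTree ∧ (∀ᶠ t in atTop, T ≤ compGraph (n t)) ∧
    ∀ M : ℕ, ∀ᶠ t in atTop, ∀ e : Pair K, T.Adj e.1.1 e.1.2 → M ≤ n t e

/-- With probability one the LSE is well defined (exists and is unique) at all late stages,
and it converges to the true merit vector. At stage `t` the LSE uses the first `n t e`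
outcomes of each pair `e`. -/
def LSEStronglyConsistent {K : ℕ} {Ω : Type*} [MeasurableSpace Ω] (P : Measure Ω)
    (n : ℕ → Pair K → ℕ) (μ : Fin K → ℝ) (ε : Pair K → ℕ → Ω → ℝ) : Prop :=
  ∀ᵐ ω ∂P,
    (∀ᶠ t in atTop, ∃! m : Fin K → ℝ, IsLSE (n t) (outcome μ ε ω) m) ∧
    ∀ mhat : ℕ → Fin K → ℝ, (∀ᶠ t in atTop, IsLSE (n t) (outcome μ ε ω) (mhat t)) →
      Tendsto mhat atTop (𝓝 μ)

end PairedComparison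

/-!
Write `d = m - μ` for the error of an estimate `m`, and `s e N` for the sum of the first `N` noise
terms of the pair `e`. By convexity the least squares estimates are the solutions of the normal
equations, which in weak form say

  `∑ e, (s e (n e) - n e * (d e.1.1 - d e.1.2)) * (h e.1.1 - h e.1.2) = 0` for every `h`

(`isLSE_outcome_iff`). Testing with the indicator of a set `S` of items gives a balance across the
cut `S`, and everything follows from such balances.

*Sufficiency.* By the strong law, `|s e N| ≤ η N + C` for every `η > 0`, with `C` depending on the
outcome. If the values of `d` spread over more than `K r`, then by pigeonhole some cut `S` is such
that `d` jumps by more than `r` along each pair crossing it (`exists_cut_of_spread`).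
With `η = r / 2` the balance across `S` bounds the number of comparisons across `S`, whereas
the tree has an edge across `S` that is compared arbitrarily often. So `d → 0`; existence and
uniqueness hold because the quadratic form is definite on a connected graph. No second moment and
no comparability of the `n e` is needed.

*Necessity.* If the pairs with `n e → ∞` do not connect the items, then some cut `S` is crossed
only by pairs whose counts are eventually constant, `n e = N e`, and not all of these constants
vanish, since otherwise the estimate could be shifted on `S`. Letting `d → 0` in the
balance across `S` shows that a signed sum of finitely many of the independent errors vanishes
almost surely, so that each of these errors is almost surely `0` (`ae_eq_zero_of_sum_ae_eq_zero`).
-/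

namespace PairedComparison

open Finset

variable {K : ℕ}

/-! ### Differences and centering -/

/-- The difference of the values of `m` at the two items of a pair, in the order of the pair. -/
def diff (m : Fin K → ℝ) (e : Pair K) : ℝ := m e.1.1 - m e.1.2

/-- The indicator function of a set of items. -/
noncomputable def ind (S : Set (Fin K)) : Fin K → ℝ := S.indicator 1

lemma diff_add (m h : Fin K → ℝ) (e : Pair K) : diff (m + h) e = diff m e + diff h e := by
  simp only [diff, Pi.add_apply]; ring

lemma diff_sub (m h : Fin K → ℝ) (e : Pair K) : diff (m - h) e = diff m e - diff h e := by
  simp only [diff, Pi.sub_apply]; ring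

lemma diff_smul (x : ℝ) (h : Fin K → ℝ) (e : Pair K) : diff (x • h) e = x * diff h e := by
  simp only [diff, Pi.smul_apply, smul_eq_mul]; ring

/-- Subtracting the mean of `h`. -/
noncomputable def center (h : Fin K → ℝ) : Fin K → ℝ := fun i => h i - (∑ j, h j) / K

lemma sum_center (h : Fin K → ℝ) : ∑ i, center h i = 0 := by
  rcases Nat.eq_zero_or_pos K with rfl | hK
  · simp
  · have : (K : ℝ) ≠ 0 := by positivity
    simp only [center, sum_sub_distrib, sum_const, card_univ, Fintype.card_fin, nsmul_eq_mul]
    field_simp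
    ring

lemma diff_center (h : Fin K → ℝ) (e : Pair K) : diff (center h) e = diff h e := by
  simp [diff, center]

lemma eq_zero_of_sum_eq_zero_of_forall_eq {m : Fin K → ℝ} (h0 : ∑ i, m i = 0)
    (h : ∀ i j, m i = m j) : m = 0 := by
  funext i
  have hK : (K : ℝ) ≠ 0 := by
    have := i.pos
    positivity
  have h1 : ∑ j, m j = K * m i := by
    rw [sum_congr rfl fun j _ => h j i]
    simp
  rw [h1] at h0
  simpa [hK] using h0

lemma abs_le_of_sum_eq_zero {d : Fin K → ℝ} (h0 : ∑ i, d i = 0) {r : ℝ}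
    (h : ∀ i j, d i - d j ≤ r) (i : Fin K) : |d i| ≤ r := by
  have hK : (0 : ℝ) < K := by
    have := i.pos
    positivity
  have h1 : K * d i = ∑ j, (d i - d j) := by
    simp [sum_sub_distrib, h0]
  have h2 : ∑ j, (d i - d j) ≤ K * r := by
    simpa using sum_le_card_nsmul univ (fun j => d i - d j) r fun j _ => h i j
  have h3 : -(K * d i) = ∑ j, (d j - d i) := by
    simp [sum_sub_distrib, h0]
  have h4 : ∑ j, (d j - d i) ≤ K * r := by
    simpa using sum_le_card_nsmul univ (fun j => d j - d i) r fun j _ => h j i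
  rw [abs_le]
  constructor
  · have : K * (-d i) ≤ K * r := by linarith
    linarith [le_of_mul_le_mul_left this hK]
  · have : K * d i ≤ K * r := by linarith
    exact le_of_mul_le_mul_left this hK

/-! ### Cuts -/

lemma diff_ind_ne_zero_iff (S : Set (Fin K)) (e : Pair K) :
    diff (ind S) e ≠ 0 ↔ ¬ (e.1.1 ∈ S ↔ e.1.2 ∈ S) := by
  by_cases h1 : e.1.1 ∈ S <;> by_cases h2 : e.1.2 ∈ S <;> simp [diff, ind, h1, h2]

lemma exists_pair_of_adj {G : SimpleGraph (Fin K)} {a b : Fin K} (h : G.Adj a b) :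
    ∃ e : Pair K, G.Adj e.1.1 e.1.2 ∧ (e.1 = (a, b) ∨ e.1 = (b, a)) := by
  rcases lt_or_gt_of_ne h.ne with hab | hab
  · exact ⟨⟨(a, b), hab⟩, h, Or.inl rfl⟩
  · exact ⟨⟨(b, a), hab⟩, h.symm, Or.inr rfl⟩

/-- A connected graph has an edge across every nontrivial cut. -/
lemma exists_adj_crossing {G : SimpleGraph (Fin K)} (hG : G.Connected) {S : Set (Fin K)}
    {i j : Fin K} (hi : i ∈ S) (hj : j ∉ S) :
    ∃ e : Pair K, G.Adj e.1.1 e.1.2 ∧ diff (ind S) e ≠ 0 := by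
  obtain ⟨p⟩ := hG.preconnected i j
  obtain ⟨⟨⟨a, b⟩, hab⟩, -, ha, hb⟩ := p.exists_boundary_dart S hi hj
  obtain ⟨e, he, h⟩ := exists_pair_of_adj hab
  refine ⟨e, he, (diff_ind_ne_zero_iff S e).2 ?_⟩
  rcases h with h | h <;> simp_all

lemma compGraph_adj_pair (c : Pair K → ℕ) (e : Pair K) :
    (compGraph c).Adj e.1.1 e.1.2 ↔ 0 < c e := by
  rw [compGraph, SimpleGraph.fromRel_adj]
  constructor
  · rintro ⟨-, ⟨_, h⟩ | ⟨h, -⟩⟩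
    · exact h
    · exact absurd h e.2.asymm
  · exact fun h => ⟨e.2.ne, Or.inl ⟨e.2, h⟩⟩

lemma forall_eq_of_diff_eq_zero {G : SimpleGraph (Fin K)} (hG : G.Connected) {m : Fin K → ℝ}
    (h : ∀ e : Pair K, G.Adj e.1.1 e.1.2 → diff m e = 0) (i j : Fin K) : m i = m j := by
  by_contra hij
  obtain ⟨e, he, hcut⟩ := exists_adj_crossing hG (S := {x | m x = m i}) (i := i) (j := j) rfl
    (fun h' => hij (Eq.symm h'))
  rw [diff_ind_ne_zero_iff] at hcut
  have := sub_eq_zero.1 (h e he)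
  simp [this] at hcut

/-- The `K` intervals `(d j + k r, d j + (k + 1) r]` cannot all contain one of the `K` values of
`d`, since `d j` lies in none of them. An empty one separates the values of `d` by more
than `r`. -/
lemma exists_cut_of_spread {d : Fin K → ℝ} {r : ℝ} (hr : 0 < r) {i j : Fin K}
    (hij : K * r < d i - d j) :
    ∃ S : Set (Fin K), i ∈ S ∧ j ∉ S ∧ ∀ a ∈ S, ∀ b ∉ S, r < d a - d b := by
  have hex : ∃ k : Fin K, ∀ x, d j + k * r < d x → d j + (k + 1) * r < d x := by
    by_contra! hcon
    choose x hx1 hx2 using hcon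
    have hinj : Function.Injective x := by
      have key : ∀ a b : Fin K, a < b → x a ≠ x b := by
        intro a b hab heq
        have h1 : ((a : ℕ) : ℝ) + 1 ≤ (b : ℕ) := by exact_mod_cast hab
        have h2 := hx2 a
        have h3 := hx1 b
        rw [← heq] at h3
        nlinarith
      intro a b hab
      by_contra hne
      rcases lt_or_gt_of_ne hne with h | h
      · exact key a b h hab
      · exact key b a h hab.symm
    obtain ⟨k, hk⟩ := Finite.surjective_of_injective hinj j
    have h1 := hx1 k
    rw [hk] at h1
    have : 0 ≤ ((k : ℕ) : ℝ) * r := by positivity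
    linarith
  obtain ⟨k, hk⟩ := hex
  have hk0 : 0 ≤ ((k : ℕ) : ℝ) * r := by positivity
  have hkK : ((k : ℕ) : ℝ) * r ≤ K * r :=
    mul_le_mul_of_nonneg_right (by exact_mod_cast k.2.le) hr.le
  refine ⟨{x | d j + k * r < d x}, ?_, ?_, ?_⟩
  · rw [Set.mem_ofPred_eq]
    linarith
  · rw [Set.mem_ofPred_eq]
    linarith
  · intro a ha b hb
    have h1 := hk a ha
    have h2 : d b ≤ d j + k * r := not_lt.1 hb
    linarith

/-! ### Normal equations -/

lemma Q_add (c : Pair K → ℕ) (y : Pair K → ℕ → ℝ) (m h : Fin K → ℝ) :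
    Q c y (m + h) = Q c y m
      - 2 * ∑ e, (∑ k ∈ range (c e), y e k - c e * diff m e) * diff h e
      + ∑ e, c e * diff h e ^ 2 := by
  have key : ∀ e : Pair K, ∑ k ∈ range (c e), (y e k - diff (m + h) e) ^ 2 =
      ∑ k ∈ range (c e), (y e k - diff m e) ^ 2
      - 2 * ((∑ k ∈ range (c e), y e k - c e * diff m e) * diff h e) + c e * diff h e ^ 2 := by
    intro e
    have h1 : ∀ k, (y e k - diff (m + h) e) ^ 2 = (y e k - diff m e) ^ 2
        - 2 * diff h e * y e k + (2 * diff m e * diff h e + diff h e ^ 2) := by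
      intro k
      rw [diff_add]
      ring
    simp only [h1, sum_add_distrib, sum_sub_distrib, ← mul_sum, sum_const, card_range,
      nsmul_eq_mul]
    ring
  change ∑ e, ∑ k ∈ range (c e), (y e k - diff (m + h) e) ^ 2 =
    ∑ e, ∑ k ∈ range (c e), (y e k - diff m e) ^ 2 - _ + _
  simp only [key, sum_add_distrib, sum_sub_distrib, mul_sum]

lemma isLSE_iff (c : Pair K → ℕ) (y : Pair K → ℕ → ℝ) (m : Fin K → ℝ) :
    IsLSE c y m ↔ ∑ i, m i = 0 ∧ ∀ h : Fin K → ℝ,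
      ∑ e, (∑ k ∈ range (c e), y e k - c e * diff m e) * diff h e = 0 := by
  constructor
  · rintro ⟨h0, hmin⟩
    refine ⟨h0, fun h => ?_⟩
    set B := ∑ e, (∑ k ∈ range (c e), y e k - c e * diff m e) * diff h e with hB
    -- The objective is a quadratic polynomial in `x` along the line `m + x • center h`,
    -- minimal at `x = 0`, so its linear coefficient vanishes.
    have hq : ∀ x : ℝ, 0 ≤ (∑ e, c e * diff h e ^ 2) * (x * x) + (-2 * B) * x + 0 := by
      intro x
      have h1 := hmin (m + x • center h) (by
        simp [sum_add_distrib, ← mul_sum, h0, sum_center])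
      rw [Q_add] at h1
      simp only [diff_smul, diff_center] at h1
      have h2 : ∑ e, (∑ k ∈ range (c e), y e k - c e * diff m e) * (x * diff h e) = x * B := by
        rw [hB, mul_sum]
        exact sum_congr rfl fun e _ => by ring
      have h3 : ∑ e, c e * (x * diff h e) ^ 2 = (∑ e, c e * diff h e ^ 2) * (x * x) := by
        rw [sum_mul]
        exact sum_congr rfl fun e _ => by ring
      rw [h2, h3] at h1
      linarith
    have hd := discrim_le_zero hq
    simp only [discrim] at hd
    nlinarith [sq_nonneg B]
  · rintro ⟨h0, hB⟩
    refine ⟨h0, fun m' _ => ?_⟩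
    have h1 := Q_add c y m (m' - m)
    rw [hB, add_sub_cancel] at h1
    have : 0 ≤ ∑ e, c e * diff (m' - m) e ^ 2 := sum_nonneg fun e _ => by positivity
    linarith

/-- The normal equations in terms of the estimation error `m - μ` and the noise. -/
lemma isLSE_outcome_iff {Ω : Type*} (c : Pair K → ℕ) (μ : Fin K → ℝ) (ε : Pair K → ℕ → Ω → ℝ)
    (ω : Ω) (m : Fin K → ℝ) :
    IsLSE c (outcome μ ε ω) m ↔ ∑ i, m i = 0 ∧ ∀ h : Fin K → ℝ,
      ∑ e, (∑ k ∈ range (c e), ε e k ω - c e * diff (m - μ) e) * diff h e = 0 := by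
  rw [isLSE_iff]
  have key : ∀ e, ∑ k ∈ range (c e), outcome μ ε ω e k - c e * diff m e =
      ∑ k ∈ range (c e), ε e k ω - c e * diff (m - μ) e := by
    intro e
    rw [diff_sub]
    simp only [outcome, sum_add_distrib, sum_const, card_range, nsmul_eq_mul, diff]
    ring
  simp only [key]

/-- On a connected comparison graph the normal equations are uniquely solvable. -/
lemma existsUnique_isLSE {c : Pair K → ℕ} (hc : (compGraph c).Connected)
    (y : Pair K → ℕ → ℝ) : ∃! m, IsLSE c y m := by
  have hconst : ∀ m : Fin K → ℝ, ∑ e, c e * diff m e ^ 2 = 0 → ∀ i j, m i = m j := by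
    intro m hm
    rw [sum_eq_zero_iff_of_nonneg fun e _ => by positivity] at hm
    refine forall_eq_of_diff_eq_zero hc fun e he => ?_
    have hpos : (c e : ℝ) ≠ 0 := by
      exact_mod_cast ((compGraph_adj_pair c e).1 he).ne'
    simpa [hpos] using hm e (mem_univ e)
  have hK : (K : ℝ) ≠ 0 := by
    have := hc.nonempty.some.pos
    positivity
  have hsmul : ∀ (x : ℝ) (m : Fin K → ℝ), ∑ i, (x • m) i = x * ∑ i, m i := fun x m => by
    simp [mul_sum]
  -- The Laplacian form plus the square of the sum is definite, hence represents every functional.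
  let L : (Fin K → ℝ) →ₗ[ℝ] Module.Dual ℝ (Fin K → ℝ) :=
    LinearMap.mk₂ ℝ (fun m h => ∑ e, c e * diff m e * diff h e + (∑ i, m i) * ∑ i, h i)
      (fun m m' h => by
        simp only [diff_add, Pi.add_apply, sum_add_distrib, mul_add, add_mul]; ring)
      (fun x m h => by
        rw [hsmul, smul_eq_mul, mul_add, mul_assoc x]
        congr 1
        simp only [diff_smul, mul_sum]
        exact sum_congr rfl fun e _ => by ring)
      (fun m h h' => by
        simp only [diff_add, Pi.add_apply, sum_add_distrib, mul_add]; ring)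
      (fun x m h => by
        rw [hsmul, smul_eq_mul, mul_add, mul_left_comm _ x]
        congr 1
        simp only [diff_smul, mul_sum]
        exact sum_congr rfl fun e _ => by ring)
  have hL : ∀ m h, L m h = ∑ e, c e * diff m e * diff h e + (∑ i, m i) * ∑ i, h i :=
    fun m h => rfl
  have hinj : Function.Injective L := by
    rw [← LinearMap.ker_eq_bot, LinearMap.ker_eq_bot']
    intro m hm
    have h1 : L m m = 0 := by rw [hm]; rfl
    rw [hL] at h1
    have h2 : ∑ e, c e * diff m e * diff m e = ∑ e, c e * diff m e ^ 2 :=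
      sum_congr rfl fun e _ => by ring
    have h3 : 0 ≤ ∑ e, c e * diff m e ^ 2 := sum_nonneg fun e _ => by positivity
    rw [h2] at h1
    have h4 := mul_self_nonneg (∑ i, m i)
    exact eq_zero_of_sum_eq_zero_of_forall_eq (mul_self_eq_zero.1 (by linarith))
      (hconst m (by linarith))
  have hsurj : Function.Surjective L :=
    (LinearMap.injective_iff_surjective_of_finrank_eq_finrank
      (Subspace.dual_finrank_eq (K := ℝ) (V := Fin K → ℝ)).symm).1 hinj
  let b : Module.Dual ℝ (Fin K → ℝ) :=
    { toFun := fun h => ∑ e, (∑ k ∈ range (c e), y e k) * diff h e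
      map_add' := fun h h' => by simp only [diff_add, mul_add, sum_add_distrib]
      map_smul' := fun x h => by
        simp only [diff_smul, RingHom.id_apply, smul_eq_mul]
        rw [mul_sum]
        exact sum_congr rfl fun e _ => by ring }
  obtain ⟨m, hm⟩ := hsurj b
  have hmh : ∀ h : Fin K → ℝ, ∑ e, c e * diff m e * diff h e + (∑ i, m i) * ∑ i, h i =
      ∑ e, (∑ k ∈ range (c e), y e k) * diff h e := fun h => by
    rw [← hL, hm]; rfl
  have hm0 : ∑ i, m i = 0 := by
    have := hmh 1
    simpa [diff, hK] using this
  refine ⟨m, (isLSE_iff c y m).2 ⟨hm0, fun h => ?_⟩, fun m' hm' => ?_⟩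
  · have := hmh h
    simp only [sub_mul, sum_sub_distrib]
    rw [hm0] at this
    linarith
  · obtain ⟨h0, hn⟩ := (isLSE_iff c y m').1 hm'
    rw [← sub_eq_zero]
    refine eq_zero_of_sum_eq_zero_of_forall_eq (by simp [h0, hm0]) (hconst _ ?_)
    have h1 := hn (m' - m)
    have h2 := hmh (m' - m)
    rw [hm0] at h2
    simp only [sub_mul, sum_sub_distrib] at h1
    have h3 : ∑ e, c e * diff (m' - m) e ^ 2 =
        ∑ e, c e * diff m' e * diff (m' - m) e - ∑ e, c e * diff m e * diff (m' - m) e := by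
      rw [← sum_sub_distrib]
      exact sum_congr rfl fun e _ => by rw [diff_sub]; ring
    rw [h3]
    linarith

/-- If the estimate is unique, then every nontrivial cut is crossed by a compared pair: otherwise
the estimate could be shifted on one side of the cut. -/
lemma exists_pos_crossing_of_existsUnique {c : Pair K → ℕ} {y : Pair K → ℕ → ℝ}
    (hu : ∃! m, IsLSE c y m) {S : Set (Fin K)} {i j : Fin K} (hi : i ∈ S) (hj : j ∉ S) :
    ∃ e, 0 < c e ∧ diff (ind S) e ≠ 0 := by
  by_contra! hcon
  obtain ⟨m, hm, huniq⟩ := hu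
  obtain ⟨h0, hn⟩ := (isLSE_iff c y m).1 hm
  have h1 : IsLSE c y (m + center (ind S)) := by
    refine (isLSE_iff c y _).2 ⟨by simp [sum_add_distrib, h0, sum_center], fun h => ?_⟩
    rw [← hn h]
    refine sum_congr rfl fun e _ => ?_
    have : (c e : ℝ) * diff (ind S) e = 0 := by
      rcases Nat.eq_zero_or_pos (c e) with h | h
      · simp [h]
      · simp [hcon e h]
    rw [diff_add, diff_center, mul_add, this, add_zero]
  have h2 : center (ind S) = 0 := by simpa using huniq _ h1
  have h3 := congrFun h2 i
  have h4 := congrFun h2 j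
  simp only [center, ind, Set.indicator_of_mem hi, Set.indicator_of_notMem hj, Pi.one_apply,
    Pi.zero_apply] at h3 h4
  linarith

/-! ### Sufficiency of the tree condition -/

/-- A sequence that is `o(N)` is bounded by `η N + C` for every `η > 0`. -/
lemma exists_abs_le_of_tendsto_div {s : ℕ → ℝ}
    (hs : Tendsto (fun N : ℕ => s N / N) atTop (𝓝 0)) {η : ℝ} (hη : 0 < η) :
    ∃ C, ∀ N, |s N| ≤ η * N + C := by
  obtain ⟨M, hM⟩ := eventually_atTop.1 ((Metric.tendsto_nhds.1 hs) η hη)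
  refine ⟨∑ k ∈ range (M + 1), |s k|, fun N => ?_⟩
  have hsum : 0 ≤ ∑ k ∈ range (M + 1), |s k| := sum_nonneg fun k _ => abs_nonneg _
  rcases lt_or_ge N (M + 1) with h | h
  · have := single_le_sum (f := fun k => |s k|) (fun k _ => abs_nonneg (s k)) (mem_range.2 h)
    have h' : 0 ≤ η * N := by positivity
    linarith
  · have h1 := hM N (by omega)
    have hN : (0 : ℝ) < N := by
      have : 0 < N := by omega
      positivity
    rw [dist_zero_right, Real.norm_eq_abs, abs_div, abs_of_pos hN, div_lt_iff₀ hN] at h1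
    linarith

/-- If the noise sum of each pair is at most `(r / 2) n_e + C` and a connected graph has all its
edges compared sufficiently often, then the estimation error spreads by at most `K r`. -/
lemma sub_le_of_normal_equations {c : Pair K → ℕ} {s : Pair K → ℝ} {d : Fin K → ℝ}
    (hd : ∀ h : Fin K → ℝ, ∑ e, (s e - c e * diff d e) * diff h e = 0)
    {r C : ℝ} (hr : 0 < r) (hC : 0 ≤ C) (hs : ∀ e, |s e| ≤ r / 2 * c e + C)
    {T : SimpleGraph (Fin K)} (hT : T.Connected)
    (hc : ∀ e : Pair K, T.Adj e.1.1 e.1.2 → Fintype.card (Pair K) * C < r / 2 * c e)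
    (i j : Fin K) : d i - d j ≤ K * r := by
  by_contra! hij
  obtain ⟨S, hi, hj, hgap⟩ := exists_cut_of_spread hr hij
  obtain ⟨f, hfT, hf⟩ := exists_adj_crossing hT hi hj
  -- A pair across the cut contributes at least `n_e r - |s e| ≥ (r / 2) n_e - C` to the balance,
  -- the other pairs contribute `0`. Only the first summand of the crossing edge `f` is kept.
  have hterm : ∀ e, (if e = f then r / 2 * c f else 0) - C ≤
      -((s e - c e * diff d e) * diff (ind S) e) := by
    intro e
    suffices h : (if diff (ind S) e = 0 then 0 else r / 2 * c e - C) ≤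
        -((s e - c e * diff d e) * diff (ind S) e) by
      refine le_trans ?_ h
      have hce : 0 ≤ r / 2 * c e := by positivity
      split_ifs with h1 h2 h2
      · exact absurd (h1 ▸ h2) hf
      · rw [h1]
      · linarith
      · linarith
    have hse := abs_le.1 (hs e)
    have hce : (0 : ℝ) ≤ c e := by positivity
    by_cases h1 : e.1.1 ∈ S <;> by_cases h2 : e.1.2 ∈ S
    · simp [diff, ind, h1, h2]
    · have hg := hgap _ h1 _ h2
      have := mul_le_mul_of_nonneg_left hg.le hce
      simp only [diff, ind, Set.indicator_of_mem h1, Set.indicator_of_notMem h2, Pi.one_apply]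
      norm_num
      linarith
    · have hg := hgap _ h2 _ h1
      have := mul_le_mul_of_nonneg_left hg.le hce
      simp only [diff, ind, Set.indicator_of_mem h2, Set.indicator_of_notMem h1, Pi.one_apply]
      norm_num
      linarith
    · simp [diff, ind, h1, h2]
  have hsum := sum_le_sum fun e (_ : e ∈ univ) => hterm e
  rw [sum_neg_distrib, hd, neg_zero, sum_sub_distrib, sum_ite_eq' univ f,
    if_pos (mem_univ f), sum_const, card_univ, nsmul_eq_mul] at hsum
  linarith [hc f hfT]

/-- The tree condition forces the estimate to exist, be unique and converge, for every noise
sequence with vanishing averages. -/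
lemma TreeCondition.tendsto {Ω : Type*} {n : ℕ → Pair K → ℕ} (hn : TreeCondition n)
    {μ : Fin K → ℝ} (hμ : ∑ i, μ i = 0) {ε : Pair K → ℕ → Ω → ℝ} {ω : Ω}
    (hω : ∀ e, Tendsto (fun N : ℕ => (∑ k ∈ range N, ε e k ω) / N) atTop (𝓝 0)) :
    (∀ᶠ t in atTop, ∃! m : Fin K → ℝ, IsLSE (n t) (outcome μ ε ω) m) ∧
    ∀ mhat : ℕ → Fin K → ℝ, (∀ᶠ t in atTop, IsLSE (n t) (outcome μ ε ω) (mhat t)) →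
      Tendsto mhat atTop (𝓝 μ) := by
  obtain ⟨T, hT, hle, hmin⟩ := hn
  have hTc := hT.connected
  refine ⟨hle.mono fun t ht => existsUnique_isLSE (hTc.mono ht) _, fun mhat hm => ?_⟩
  have hK : (0 : ℝ) < K := by
    have := hTc.nonempty.some.pos
    positivity
  rw [tendsto_pi_nhds]
  intro i
  rw [Metric.tendsto_nhds]
  intro δ hδ
  obtain ⟨r, hr, hrδ⟩ : ∃ r : ℝ, 0 < r ∧ K * r < δ :=
    ⟨δ / (2 * K), by positivity, by field_simp; norm_num⟩
  choose C hC using fun e => exists_abs_le_of_tendsto_div (hω e) (half_pos hr)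
  have hC0 : ∀ e, 0 ≤ C e := fun e => by simpa using hC e 0
  obtain ⟨M, hM⟩ := exists_nat_gt (Fintype.card (Pair K) * (∑ e, C e) / (r / 2))
  filter_upwards [hm, hmin M] with t ht hMt
  obtain ⟨h0, hnorm⟩ := (isLSE_outcome_iff _ _ _ _ _).1 ht
  have hbound := sub_le_of_normal_equations hnorm hr (sum_nonneg fun e _ => hC0 e)
    (fun e => (hC e (n t e)).trans (by
      gcongr
      exact single_le_sum (fun e _ => hC0 e) (mem_univ e))) hTc
    (fun e he => by
      have h1 : (M : ℝ) ≤ n t e := by exact_mod_cast hMt e he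
      rw [div_lt_iff₀ (half_pos hr)] at hM
      nlinarith)
  have h2 := abs_le_of_sum_eq_zero (d := mhat t - μ) (by simp [h0, hμ]) hbound i
  rw [Real.dist_eq]
  exact h2.trans_lt hrδ

/-! ### Necessity of the tree condition -/

/-- The term `a q₀ X q₀` is independent of the rest `Z` of the sum, while `Z = -a q₀ X q₀`. Hence
`E |a q₀ X q₀| = -E[sign(Z) (a q₀ X q₀)] = -E[sign(Z)] E[a q₀ X q₀] = 0`, without any second
moment. -/
lemma ae_eq_zero_of_sum_ae_eq_zero {Ω ι : Type*} [MeasurableSpace Ω] {P : Measure Ω}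
    {X : ι → Ω → ℝ} (hX : iIndepFun X P) (hint : ∀ q, Integrable (X q) P)
    (hmean : ∀ q, ∫ ω, X q ω ∂P = 0) (I : Finset ι) (a : ι → ℝ)
    (hsum : ∀ᵐ ω ∂P, ∑ q ∈ I, a q * X q ω = 0) {q₀ : ι} (hq₀ : q₀ ∈ I) (ha : a q₀ ≠ 0) :
    ∀ᵐ ω ∂P, X q₀ ω = 0 := by
  classical
  let Y : ι → Ω → ℝ := fun q ω => a q * X q ω
  have hY : iIndepFun Y P := hX.comp (fun q x => a q * x) fun q => measurable_const_mul _
  have hYint : ∀ q, Integrable (Y q) P := fun q => (hint q).const_mul _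
  let Z : Ω → ℝ := ∑ q ∈ I.erase q₀, Y q
  have hind : IndepFun Z (Y q₀) P :=
    hY.indepFun_finsetSum_of_notMem₀ (fun q => (hYint q).aemeasurable) (notMem_erase q₀ I)
  let φ : ℝ → ℝ := fun x => if 0 < x then 1 else -1
  have hφ : Measurable φ := Measurable.ite measurableSet_Ioi measurable_const measurable_const
  have hZ : AEMeasurable Z P := by
    refine Finset.aemeasurable_sum _ fun q _ => (hYint q).aemeasurable
  have hZY : ∀ᵐ ω ∂P, φ (Z ω) * Y q₀ ω = -|Y q₀ ω| := by
    filter_upwards [hsum] with ω hω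
    have h1 : Z ω = -Y q₀ ω := by
      rw [← add_sum_erase _ _ hq₀] at hω
      simp only [Z, Finset.sum_apply, Y]
      linarith
    rw [h1]
    by_cases h : 0 < -Y q₀ ω
    · rw [abs_of_neg (by linarith)]
      simp [φ, h]
    · rw [abs_of_nonneg (by linarith)]
      simp only [φ, if_neg h]
      ring
  have hprod := (hind.comp hφ measurable_id).integral_fun_mul_eq_mul_integral
    (hφ.comp_aemeasurable hZ).aestronglyMeasurable (hYint q₀).aestronglyMeasurable
  have hY0 : ∫ ω, Y q₀ ω ∂P = 0 := by
    simp only [Y, integral_const_mul, hmean, mul_zero]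
  simp only [Function.comp_apply, id_eq] at hprod
  rw [hY0, mul_zero, integral_congr_ae hZY, integral_neg, neg_eq_zero,
    integral_eq_zero_iff_of_nonneg (fun ω => abs_nonneg _) (hYint q₀).abs] at hprod
  filter_upwards [hprod] with ω hω
  simpa [Y, ha] using hω

/-- If monotone counts violate the tree condition, then some cut is crossed only by pairs whose
counts are eventually constant. -/
lemma exists_cut_eventually_const {n : ℕ → Pair K → ℕ} (hmono : ∀ e, Monotone fun t => n t e)
    (hK : 0 < K) (hn : ¬ TreeCondition n) :
    ∃ (S : Set (Fin K)) (u v : Fin K), u ∈ S ∧ v ∉ S ∧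
      ∀ e, diff (ind S) e ≠ 0 → ∃ N, ∀ᶠ t in atTop, n t e = N := by
  let G : SimpleGraph (Fin K) := SimpleGraph.fromRel
    fun i j => ∃ h : i < j, Tendsto (fun t => n t ⟨(i, j), h⟩) atTop atTop
  have hG : ∀ e : Pair K, G.Adj e.1.1 e.1.2 ↔ Tendsto (fun t => n t e) atTop atTop := by
    intro e
    rw [SimpleGraph.fromRel_adj]
    constructor
    · rintro ⟨-, ⟨_, h⟩ | ⟨h, -⟩⟩
      · exact h
      · exact absurd h e.2.asymm
    · exact fun h => ⟨e.2.ne, Or.inl ⟨e.2, h⟩⟩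
  have : Nonempty (Fin K) := ⟨⟨0, hK⟩⟩
  have hnc : ¬ G.Preconnected := by
    intro hpre
    obtain ⟨T, hTG, hT⟩ := (SimpleGraph.Connected.mk hpre).exists_isTree_le
    have hlarge : ∀ M : ℕ, ∀ᶠ t in atTop, ∀ e : Pair K, T.Adj e.1.1 e.1.2 → M ≤ n t e := by
      intro M
      rw [eventually_all]
      intro e
      by_cases he : T.Adj e.1.1 e.1.2
      · filter_upwards [((hG e).1 (hTG he)).eventually_ge_atTop M] with t ht _ using ht
      · exact Eventually.of_forall fun t h => absurd h he
    refine hn ⟨T, hT, (hlarge 1).mono fun t ht a b hab => ?_, hlarge⟩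
    obtain ⟨e, he, h⟩ := exists_pair_of_adj hab
    have hadj := (compGraph_adj_pair (n t) e).2 (ht e he)
    rcases h with h | h
    · simpa [h] using hadj
    · simpa [h] using hadj.symm
  simp only [SimpleGraph.Preconnected, not_forall] at hnc
  obtain ⟨u, v, huv⟩ := hnc
  refine ⟨{x | G.Reachable u x}, u, v, SimpleGraph.Reachable.refl u, huv, fun e he => ?_⟩
  rw [diff_ind_ne_zero_iff] at he
  have hnadj : ¬ G.Adj e.1.1 e.1.2 := fun hadj =>
    he ⟨fun h => h.trans hadj.reachable, fun h => h.trans hadj.symm.reachable⟩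
  rw [hG] at hnadj
  obtain ⟨N, hN⟩ := (tendsto_atTop_of_monotone (hmono e)).resolve_left hnadj
  rw [nhds_discrete, tendsto_pure] at hN
  exact ⟨N, hN⟩

/-- Passing to the limit in the balance across a cut whose crossing pairs have eventually constant
counts. -/
lemma sum_noise_eq_zero_of_tendsto {Ω : Type*} {n : ℕ → Pair K → ℕ} {μ : Fin K → ℝ}
    {ε : Pair K → ℕ → Ω → ℝ} {ω : Ω} {mhat : ℕ → Fin K → ℝ}
    (hm : ∀ᶠ t in atTop, IsLSE (n t) (outcome μ ε ω) (mhat t))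
    (hlim : Tendsto mhat atTop (𝓝 μ)) {S : Set (Fin K)} {N : Pair K → ℕ}
    (hN : ∀ e, diff (ind S) e ≠ 0 → ∀ᶠ t in atTop, n t e = N e) :
    ∑ e, (∑ k ∈ range (N e), ε e k ω) * diff (ind S) e = 0 := by
  have hd : ∀ e : Pair K, Tendsto (fun t => diff (mhat t - μ) e) atTop (𝓝 0) := by
    intro e
    have h1 : ∀ i, Tendsto (fun t => (mhat t - μ) i) atTop (𝓝 0) := fun i => by
      simpa using ((tendsto_pi_nhds.1 hlim) i).sub_const (μ i)
    simpa [diff] using (h1 e.1.1).sub (h1 e.1.2)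
  have hconv : Tendsto (fun t => ∑ e, (∑ k ∈ range (N e), ε e k ω
      - N e * diff (mhat t - μ) e) * diff (ind S) e) atTop
      (𝓝 (∑ e, (∑ k ∈ range (N e), ε e k ω - N e * 0) * diff (ind S) e)) :=
    tendsto_finsetSum _ fun e _ => (((hd e).const_mul _).const_sub _).mul_const _
  simp only [mul_zero, sub_zero] at hconv
  refine tendsto_nhds_unique hconv (tendsto_const_nhds.congr' ?_)
  have hN' : ∀ᶠ t in atTop, ∀ e, diff (ind S) e ≠ 0 → n t e = N e := by
    rw [eventually_all]
    intro e
    by_cases he : diff (ind S) e = 0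
    · exact Eventually.of_forall fun t h => absurd he h
    · exact (hN e he).mono fun t ht _ => ht
  filter_upwards [hm, hN'] with t ht hNt
  rw [← ((isLSE_outcome_iff _ _ _ _ _).1 ht).2 (ind S)]
  refine sum_congr rfl fun e _ => ?_
  by_cases he : diff (ind S) e = 0
  · simp [he]
  · rw [hNt e he]

/-- Consistency with accumulating comparisons and nondegenerate errors forces the tree
condition. -/
lemma LSEStronglyConsistent.treeCondition {Ω : Type*} [MeasurableSpace Ω] {P : Measure Ω}
    [NeZero P] {n : ℕ → Pair K → ℕ} {μ : Fin K → ℝ} {ε : Pair K → ℕ → Ω → ℝ}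
    (hcons : LSEStronglyConsistent P n μ ε)
    (hindep : iIndepFun (fun q : Pair K × ℕ => ε q.1 q.2) P)
    (hint : ∀ e k, Integrable (ε e k) P) (hmean : ∀ e k, ∫ ω, ε e k ω ∂P = 0)
    (hmono : ∀ e, Monotone fun t => n t e) (hK : 0 < K)
    (hne : ∀ e k, ¬ (∀ᵐ ω ∂P, ε e k ω = 0)) : TreeCondition n := by
  by_contra hn
  obtain ⟨S, u, v, hu, hv, hS⟩ := exists_cut_eventually_const hmono hK hn
  choose! N hN using hS
  have hN' : ∀ᶠ t in atTop, ∀ e, diff (ind S) e ≠ 0 → n t e = N e := by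
    rw [eventually_all]
    intro e
    by_cases he : diff (ind S) e = 0
    · exact Eventually.of_forall fun t h => absurd he h
    · exact (hN e he).mono fun t ht _ => ht
  obtain ⟨e₀, he₀, hpos⟩ : ∃ e, diff (ind S) e ≠ 0 ∧ 0 < N e := by
    obtain ⟨ω, hω, -⟩ := hcons.exists
    obtain ⟨t, htu, htN⟩ := (hω.and hN').exists
    obtain ⟨e, hpos, he⟩ := exists_pos_crossing_of_existsUnique htu hu hv
    exact ⟨e, he, htN e he ▸ hpos⟩
  let I : Finset (Pair K × ℕ) :=
    (univ.sigma fun e => range (N e)).map (Equiv.sigmaEquivProd (Pair K) ℕ).toEmbedding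
  refine hne e₀ 0 (ae_eq_zero_of_sum_ae_eq_zero hindep (fun q => hint _ _) (fun q => hmean _ _) I
    (fun q => diff (ind S) q.1) ?_ (q₀ := (e₀, 0)) ?_ he₀)
  · filter_upwards [hcons] with ω hω
    have hsel : ∃ mhat : ℕ → Fin K → ℝ, ∀ᶠ t in atTop, IsLSE (n t) (outcome μ ε ω) (mhat t) := by
      have h1 : ∀ t, ∃ m, (∃! m : Fin K → ℝ, IsLSE (n t) (outcome μ ε ω) m) →
          IsLSE (n t) (outcome μ ε ω) m := fun t => by
        by_cases h : ∃! m : Fin K → ℝ, IsLSE (n t) (outcome μ ε ω) m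
        · exact ⟨h.choose, fun _ => h.choose_spec.1⟩
        · exact ⟨0, fun h' => absurd h' h⟩
      choose mhat hmhat using h1
      exact ⟨mhat, hω.1.mono hmhat⟩
    obtain ⟨mhat, hmhat⟩ := hsel
    rw [← sum_noise_eq_zero_of_tendsto hmhat (hω.2 mhat hmhat) hN, sum_map, sum_sigma]
    refine sum_congr rfl fun e _ => ?_
    rw [sum_mul]
    exact sum_congr rfl fun k _ => mul_comm _ _
  · exact mem_map.2 ⟨⟨e₀, 0⟩, by simpa using hpos, rfl⟩

end PairedComparison

theorem mainTheorem1 {Ω : Type*} [MeasurableSpace Ω] (P : Measure Ω) [IsProbabilityMeasure P]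
    (K : ℕ) (μ : Fin K → ℝ) (hμ : ∑ i, μ i = 0)
    (ε : PairedComparison.Pair K → ℕ → Ω → ℝ)
    (hindep : iIndepFun (fun q : PairedComparison.Pair K × ℕ => ε q.1 q.2) P)
    (hident : ∀ (e e' : PairedComparison.Pair K) (k k' : ℕ),
      IdentDistrib (ε e k) (ε e' k') P P)
    (hint : ∀ (e : PairedComparison.Pair K) (k : ℕ), Integrable (ε e k) P)
    (hmean : ∀ (e : PairedComparison.Pair K) (k : ℕ), ∫ ω, ε e k ω ∂P = 0)
    (n : ℕ → PairedComparison.Pair K → ℕ)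
    (hn : Tendsto (fun t => ∑ e, n t e) atTop atTop) :
    (PairedComparison.TreeCondition n →
      PairedComparison.LSEStronglyConsistent P n μ ε) ∧
    ((∀ e, Monotone (fun t => n t e)) →
      (∀ e k, ¬ (∀ᵐ ω ∂P, ε e k ω = 0)) →
      (PairedComparison.LSEStronglyConsistent P n μ ε ↔ PairedComparison.TreeCondition n)) := by
  have hsuff : PairedComparison.TreeCondition n →
      PairedComparison.LSEStronglyConsistent P n μ ε := by
    intro hT
    have hslln : ∀ᵐ ω ∂P, ∀ e, Tendsto
        (fun N : ℕ => (∑ k ∈ Finset.range N, ε e k ω) / N) atTop (𝓝 0) := by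
      rw [ae_all_iff]
      intro e
      have h := strong_law_ae_real (ε e) (hint e 0)
        (fun k k' hkk' => hindep.indepFun (i := (e, k)) (j := (e, k')) (by simpa using hkk'))
        (fun k => hident e e k 0)
      rwa [hmean e 0] at h
    filter_upwards [hslln] with ω hω using hT.tendsto hμ hω
  have hK : 0 < K := by
    -- Without items there are no pairs, so the total number of comparisons would be constant.
    rcases Nat.eq_zero_or_pos K with rfl | hK
    · simp [not_tendsto_const_atTop] at hn
    · exact hK
  exact ⟨hsuff, fun hmono hne =>
    ⟨fun hcons => hcons.treeCondition hindep hint hmean hmono hK hne, hsuff⟩⟩
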